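/- Let $p$ be a prime and let $R=\mathrm{GR}(p^{\nu},d)\subseteq S=\mathrm{GR}(p^{\nu},dm)$ be Galois rings ($\nu,d,m\ge 1$), let $\sigma$ be a generator of the (cyclic) group $\mathrm{Gal}_R(S)$ of ring automorphisms of $S$ fixing $R$, and let $S[x;\sigma]$ be the skew polynomial ring with $x a=\sigma(a)x$ for $a\in S$; put $\deg 0=-\infty$. For $f=\sum_i f_i x^i\in S[x;\sigma]$ and $a\in S$ put $f(a)=\sum_i f_i\,\sigma^i(a)$. Call $f$ *primitive* if some coefficient $f_i$ is a unit. For $\mathbf e\in S^n$, an *annihilator polynomial* of $\mathbf e$ is a primitive polynomial of minimal degree among the primitive $\Lambda\in S[x;\sigma]$ with $\Lambda(e_i)=0$ for all $i$. Fix an $R$-basis $\gamma_1,\dots,\gamma_m$ of $S$; the rank $\mathrm{rk}(\mathbf e)$ is the number of nonzero diagonal entries of a Smith normal form over $R$ of the matrix $(E_{ij})\in R^{m\times n}$ defined by $e_j=\sum_i E_{ij}\gamma_i$. Let $0<k\le n$, let $\mathbf g=(g_1,\dots,g_n)\in S^n$ have entries linearly independent over $R$, and let $\mathcal C=\{(f(g_1),\dots,f(g_n))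 : f\in S[x;\sigma],\ \deg f<k\}$ be the Gabidulin code with support $\mathbf g$. Let $\mathbf h\in S^n$ have entries linearly independent over $R$ and be such that $[\sigma^i(h_j)]_{0\le i<n-k,\,1\le j\le n}$ is a parity-check matrix of $\mathcal C$. For $\mathbf r\in S^n$ let $s=\sum_{i=0}^{n-k-1}\bigl(\sum_{j=1}^n\sigma^i(h_j)r_j\bigr)x^i$ be its syndrome polynomial. **Theorem.** Let $\mathbf r=\mathbf c+\mathbf e$, where $\mathbf c=(f(g_1),\dots,f(g_n))\in\mathcal C$ with $\deg f<k$ and $t:=\mathrm{rk}(\mathbf e)\le\frac{n-k}{2}$, and let $s$ be the syndrome polynomial of $\mathbf r$. Let $u,v\in S[x;\sigma]$ be such that $u$ is primitive, $u s\equiv v \bmod x^{n-k}$, $\deg u\le t$ and $\deg v<\deg u$. Then $u$ is an annihilator polynomial of $\mathbf e$, and $\deg u=t$. Furthermore, there is a unique $I\in S[x;\sigma]$ with $\deg I<n$ and $I(g_i)=r_i$ for all $i$ (the interpolation polynomial of $\mathbf r$); there is a unique monic annihilator polynomial of $\mathbf g$; every annihilator polynomial $G$ of $\mathbf g$ has degree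 $n$; and for every such $G$, $$u I\equiv u f \ \mathrm{mod}_{\mathrm r}\ G,\qquad\text{i.e. } uI-uf=qG\text{ for some }q\in S[x;\sigma].$$ -/

import Mathlib

open Polynomial in
/-- `A` is a Galois ring `GR(p^ν, d)`: it is isomorphic to `(ℤ/p^ν)[x]/(f)` for a monic `f` of
degree `d` whose reduction modulo `p` is irreducible over `𝔽_p`. -/
def IsGaloisRing (p ν d : ℕ) (A : Type*) [CommRing A] : Prop :=
  p.Prime ∧ ∃ (hν : ν ≠ 0) (f : (ZMod (p ^ ν))[X]), f.Monic ∧ f.natDegree = d ∧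
    Irreducible (f.map (ZMod.castHom (dvd_pow_self p hν) (ZMod p))) ∧
    Nonempty (A ≃+* (ZMod (p ^ ν))[X] ⧸ Ideal.span {f})

section SmithRank

variable {A : Type*} [CommRing A] {a b : ℕ}

/-- The diagonal entries `d_0, …, d_{min(a,b)-1}` of a rectangular matrix. -/
def rectDiag (D : Matrix (Fin a) (Fin b) A) (l : Fin (min a b)) : A :=
  D (Fin.castLE (min_le_left a b) l) (Fin.castLE (min_le_right a b) l)

/-- `D = P M Q` with `P`, `Q` invertible, `D` diagonal, and each diagonal entry dividing the later
ones. In a Galois ring, where the ideals are the powers of the maximal ideal, `d_i ∣ d_j` means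
`v(d_i) ≤ v(d_j)`. -/
structure IsSmithNormalForm (M D : Matrix (Fin a) (Fin b) A) : Prop where
  equiv : ∃ (P : GL (Fin a) A) (Q : GL (Fin b) A),
    D = (P : Matrix (Fin a) (Fin a) A) * M * (Q : Matrix (Fin b) (Fin b) A)
  diagonal : ∀ (i : Fin a) (j : Fin b), (i : ℕ) ≠ (j : ℕ) → D i j = 0
  chain : ∀ l l' : Fin (min a b), l ≤ l' → rectDiag D l ∣ rectDiag D l'

/-- The rank of a matrix over a Galois ring: the number of nonzero diagonal entries of a Smith
normal form. (Over a Galois ring a Smith normal form exists and all of them give the same number.) -/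
noncomputable def smithRank (M : Matrix (Fin a) (Fin b) A) : ℕ :=
  sInf {t : ℕ | ∃ D, IsSmithNormalForm M D ∧ t = {l | rectDiag D l ≠ 0}.ncard}

/-- The expansion of `e ∈ B^n` into an `m × n` matrix over `A`: its `j`-th column holds the
coordinates of `e_j` in the basis `γ`. -/
noncomputable def extMatrix {B : Type*} [CommRing B] [Algebra A B] {m n : ℕ} (γ : Module.Basis (Fin m) A B)
    (e : Fin n → B) : Matrix (Fin m) (Fin n) A :=
  Matrix.of fun i j => γ.repr (e j) i

/-- The rank norm of `e ∈ B^n` over `A`. -/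
noncomputable def rankNorm {B : Type*} [CommRing B] [Algebra A B] {m n : ℕ}
    (γ : Module.Basis (Fin m) A B) (e : Fin n → B) : ℕ :=
  smithRank (extMatrix γ e)

end SmithRank

namespace SkewPolynomial

/-- The degree of a skew polynomial, with `degree 0 = ⊥`. -/
def degree {S : Type*} [CommRing S] (f : SkewPolynomial S) : WithBot ℕ := f.support.max

/-- Some coefficient is a unit. -/
def IsPrimitive {S : Type*} [CommRing S] (f : SkewPolynomial S) : Prop :=
  ∃ i, IsUnit (f.coeff i)

/-- The leading coefficient is `1`. -/
def IsMonic {S : Type*} [CommRing S] (f : SkewPolynomial S) : Prop :=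
  ∃ d : ℕ, f.degree = d ∧ f.coeff d = 1

/- From here on, `S` carries an action of the monoid `(ℕ, +)`; its generator acts by the
endomorphism `φ`, and `SkewPolynomial S` is the skew polynomial ring with `X * a = φ a * X`. -/
variable {S : Type*} [CommRing S] [MulSemiringAction (Multiplicative ℕ) S]

/-- The operator evaluation `f(a) = ∑ f_i φ^i(a)`. -/
noncomputable def opEval (f : SkewPolynomial S) (a : S) : S :=
  f.sum fun i c => c * (φ^[i] a)

/-- Congruence modulo right division by `G`: the difference lies in the left ideal generated
by `G`. -/
def RightModEq (G f h : SkewPolynomial S) : Prop :=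
  ∃ q : SkewPolynomial S, f - h = q * G

/-- A primitive skew polynomial of minimal degree among those that vanish at all `e_i`. -/
structure IsAnnihilator {n : ℕ} (e : Fin n → S) (L : SkewPolynomial S) : Prop where
  primitive : L.IsPrimitive
  vanish : ∀ i, L.opEval (e i) = 0
  minimal : ∀ L' : SkewPolynomial S, L'.IsPrimitive → (∀ i, L'.opEval (e i) = 0) →
    L.degree ≤ L'.degree

/-- The Gabidulin code of dimension `k` and support `g`. -/
def gabidulinCode {n : ℕ} (g : Fin n → S) (k : ℕ) : Set (Fin n → S) :=
  {c | ∃ f : SkewPolynomial S, f.degree < k ∧ c = fun j => f.opEval (g j)}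

/-- The matrix `[φ^i(h_j)]` with `N` rows. -/
def mooreMatrix {n : ℕ} (N : ℕ) (h : Fin n → S) : Matrix (Fin N) (Fin n) S :=
  Matrix.of fun i j => φ^[(i : ℕ)] (h j)

/-- The syndrome polynomial `∑_{i < N} (∑_j φ^i(h_j) y_j) x^i` of a word `y`. -/
noncomputable def syndromePoly {n : ℕ} (N : ℕ) (h y : Fin n → S) : SkewPolynomial S :=
  ∑ i : Fin N, monomial (i : ℕ) ((mooreMatrix N h).mulVec y i)

end SkewPolynomial

/-- `H` is a parity-check matrix of the code `C`. -/
def IsParityCheckMatrix {S : Type*} [CommRing S] {N n : ℕ} (H : Matrix (Fin N) (Fin n) S)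
    (C : Set (Fin n → S)) : Prop :=
  ∀ c : Fin n → S, c ∈ C ↔ H.mulVec c = 0

/-!
The error `e` enters the key equation only through a rank decomposition. A Smith normal form of
its coordinate matrix gives `e_j = ∑ l, V l j • δ l • β l` with `t` elements `β l` linearly
independent over `R`, nonzero scalars `δ l` and a right-invertible matrix `V`
(`exists_rankNorm_decomposition`). With `w l = ∑ j, V l j • h j`, the coefficient of `x ^ i` in
`u * s` is `∑ l, σ ^ i (w l) * u (δ l • β l)` whenever `deg u ≤ i < n - k`. It is zero for
`t ≤ i < 2 t`, because `deg v < t`; this is a square linear system in the values `u (δ l • β l)`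
whose matrix is a Moore matrix, so `u` vanishes at every `δ l • β l`, hence on `e`
(`SkewPolynomial.opEval_eq_zero_of_key_equation`). Conversely, a primitive `L` vanishing on `e`
sends every `β l` into the maximal ideal, because `δ l ≠ 0`; if its degree were less than `t`,
inverting the Moore matrix of the `β l` would put all its coefficients into the maximal ideal
(`SkewPolynomial.IsPrimitive.le_degree_of_opEval_eq_zero`). So `u` has the minimal degree `t`.

Everything rests on the invertibility of the Moore matrix of a family that is linearly independent
over `R` (`isUnit_det_mooreMatrix`). Since `S` is local, it can be checked over the residue field,
where Artin's argument applies (`eq_zero_of_sum_iterate_mul_eq_zero`) once the elements fixed by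
`σ` modulo `p` are known to come from `R`. For the latter
(`IsGaloisRing.exists_residue_eq_of_fixed`) the relative Frobenius of the residue fields is lifted
to an `R`-automorphism of `S` by Newton iteration: a Galois ring is generated by one root of a
polynomial that is separable modulo `p`.

Invertibility of the Moore matrix of `g` also gives the interpolation polynomial `I` and the monic
annihilator `x ^ n - ⋯`, of which all annihilators of `g` are unit multiples. Finally,
`u * I - u * f` takes the value `u (r_j - c_j) = u (e_j) = 0` at `g_j`, so its remainder on right division by
an annihilator `G` of `g`, a skew polynomial of degree less than `n` vanishing on `g`, is zero.
-/

/-! ### Evaluation, coefficients and right division of skew polynomials -/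

namespace SkewPolynomial

section Basic

variable {S : Type*} [CommRing S]

theorem degree_lt_iff {f : SkewPolynomial S} {N : ℕ} :
    f.degree < N ↔ ∀ i, N ≤ i → f.coeff i = 0 := by
  rw [degree, Finset.max_eq_sup_withBot, Nat.cast_withBot,
    Finset.sup_lt_iff (WithBot.bot_lt_coe N)]
  refine ⟨fun H i hi => by_contra fun h => ?_, fun H i hi => ?_⟩
  · exact absurd (WithBot.coe_lt_coe.mp (H i (mem_support_iff.mpr h))) (by omega)
  · exact WithBot.coe_lt_coe.mpr (lt_of_not_ge fun h => mem_support_iff.mp hi (H i h))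

theorem degree_le_iff {f : SkewPolynomial S} {N : ℕ} :
    f.degree ≤ N ↔ ∀ i, N < i → f.coeff i = 0 := by
  refine ⟨fun H i hi => by_contra fun h => ?_, fun H => Finset.max_le fun i hi => ?_⟩
  · have : (i : WithBot ℕ) ≤ N := (Finset.le_max (mem_support_iff.mpr h)).trans H
    exact absurd hi (not_lt.mpr (by exact_mod_cast this))
  · exact WithBot.coe_le_coe.mpr (le_of_not_gt fun h => mem_support_iff.mp hi (H i h))

theorem le_degree_of_coeff_ne_zero {f : SkewPolynomial S} {i : ℕ} (h : f.coeff i ≠ 0) :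
    (i : WithBot ℕ) ≤ f.degree :=
  Finset.le_max (mem_support_iff.mpr h)

theorem degree_eq_of_coeff_ne_zero {f : SkewPolynomial S} {N : ℕ}
    (h : ∀ i, N < i → f.coeff i = 0) (h' : f.coeff N ≠ 0) : f.degree = N :=
  le_antisymm (degree_le_iff.mpr h) (le_degree_of_coeff_ne_zero h')

theorem coeff_sum_monomial {N : ℕ} (a : Fin N → S) (i : ℕ) :
    (∑ l : Fin N, monomial (l : ℕ) (a l)).coeff i = if h : i < N then a ⟨i, h⟩ else 0 := by
  have key : ∀ s : Finset (Fin N), (∑ l ∈ s, monomial (l : ℕ) (a l)).coeff i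
      = ∑ l ∈ s, if (l : ℕ) = i then a l else 0 := fun s => by
    classical
    induction s using Finset.induction_on with
    | empty => simp
    | insert x s hx ih => rw [Finset.sum_insert hx, Finset.sum_insert hx, coeff_add, ih,
        coeff_monomial]
  rw [key]
  split_ifs with h
  · rw [Finset.sum_eq_single ⟨i, h⟩] <;> simp +contextual [Fin.ext_iff]
  · exact Finset.sum_eq_zero fun l _ => if_neg (by have := l.2; omega)

variable [MulSemiringAction (Multiplicative ℕ) S]

theorem coeff_monomial_mul (m : ℕ) (a : S) (f : SkewPolynomial S) (i : ℕ) :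
    (monomial m a * f).coeff i = if m ≤ i then a * φ^[m] (f.coeff (i - m)) else 0 := by
  induction f using SkewPolynomial.induction with
  | h0 => simp
  | ha n r q _ _ ih =>
    rw [mul_add, coeff_add, ih, monomial_mul_monomial, coeff_monomial, coeff_add, coeff_monomial]
    split_ifs <;> first | omega | simp [iterate_map_add, mul_add]

theorem coeff_mul (f g : SkewPolynomial S) (i : ℕ) :
    (f * g).coeff i = ∑ a ∈ Finset.range (i + 1), f.coeff a * φ^[a] (g.coeff (i - a)) := by
  induction f using SkewPolynomial.induction with
  | h0 => simp
  | ha n r q _ _ ih =>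
    simp only [add_mul, coeff_add, ih, coeff_monomial_mul, Finset.sum_add_distrib, coeff_monomial,
      ite_mul, zero_mul]
    congr 1
    simp

theorem coeff_mul_X_pow_of_lt (f : SkewPolynomial S) {N i : ℕ} (h : i < N) :
    (f * X ^ N).coeff i = 0 := by
  rw [coeff_mul]
  refine Finset.sum_eq_zero fun a _ => ?_
  rw [X_pow_eq_monomial, coeff_monomial, if_neg (by omega), iterate_map_zero, mul_zero]

theorem opEval_eq_sum_range (f : SkewPolynomial S) {N : ℕ} (h : ∀ i, N ≤ i → f.coeff i = 0)
    (a : S) : f.opEval a = ∑ i ∈ Finset.range N, f.coeff i * φ^[i] a := by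
  refine sum_eq_of_subset _ (fun i => zero_mul _) fun i hi => ?_
  exact Finset.mem_range.mpr (lt_of_not_ge fun h' => mem_support_iff.mp hi (h i h'))

theorem opEval_add_left (f g : SkewPolynomial S) (a : S) :
    (f + g).opEval a = f.opEval a + g.opEval a :=
  sum_add_index f g _ (fun _ => zero_mul _) fun _ _ _ => add_mul _ _ _

@[simp] theorem opEval_monomial (i : ℕ) (c a : S) : (monomial i c).opEval a = c * φ^[i] a :=
  sum_monomial_index (h := fun i c => c * φ^[i] a) (zero_mul _)

@[simp] theorem opEval_zero_left (a : S) : (0 : SkewPolynomial S).opEval a = 0 :=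
  sum_zero_index _

theorem opEval_sub_left (f g : SkewPolynomial S) (a : S) :
    (f - g).opEval a = f.opEval a - g.opEval a := by
  rw [eq_sub_iff_add_eq, ← opEval_add_left, sub_add_cancel]

theorem opEval_add (f : SkewPolynomial S) (a b : S) :
    f.opEval (a + b) = f.opEval a + f.opEval b := by
  simp only [opEval, iterate_map_add, mul_add, sum_add]

@[simp] theorem opEval_zero (f : SkewPolynomial S) : f.opEval 0 = 0 := by
  simp [opEval, iterate_map_zero]

theorem opEval_sum (f : SkewPolynomial S) {ι : Type*} (s : Finset ι) (a : ι → S) :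
    f.opEval (∑ j ∈ s, a j) = ∑ j ∈ s, f.opEval (a j) :=
  map_sum (⟨⟨f.opEval, f.opEval_zero⟩, f.opEval_add⟩ : S →+ S) a s

theorem opEval_mul_of_fixed (f : SkewPolynomial S) {c : S} (hc : φ c = c) (a : S) :
    f.opEval (c * a) = c * f.opEval a := by
  simp only [opEval, iterate_map_mul, Function.iterate_fixed hc, sum_def, Finset.mul_sum]
  exact Finset.sum_congr rfl fun i _ => by ring

theorem opEval_monomial_mul (n : ℕ) (r : S) (g : SkewPolynomial S) (a : S) :
    (monomial n r * g).opEval a = r * φ^[n] (g.opEval a) := by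
  induction g using SkewPolynomial.induction with
  | h0 => simp
  | ha m s q _ _ ih =>
    rw [mul_add, opEval_add_left, ih, opEval_add_left, monomial_mul_monomial]
    simp only [opEval_monomial, iterate_map_add, iterate_map_mul, Function.iterate_add_apply]
    ring

/-- Evaluation turns the product of skew polynomials into the composition of operators. -/
theorem opEval_mul (f g : SkewPolynomial S) (a : S) :
    (f * g).opEval a = f.opEval (g.opEval a) := by
  induction f using SkewPolynomial.induction with
  | h0 => simp
  | ha n r q _ _ ih =>
    rw [add_mul, opEval_add_left, opEval_add_left, ih, opEval_monomial_mul, opEval_monomial]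

/-- Right division by a monic skew polynomial of degree `n`. -/
theorem exists_coeff_sub_mul_eq_zero {G : SkewPolynomial S} {n : ℕ}
    (hG : ∀ i, n < i → G.coeff i = 0) (hGn : G.coeff n = 1) (f : SkewPolynomial S) :
    ∃ q : SkewPolynomial S, ∀ i, n ≤ i → (f - q * G).coeff i = 0 := by
  have key : ∀ (N : ℕ) (f : SkewPolynomial S), (∀ i, n + N ≤ i → f.coeff i = 0) →
      ∃ q : SkewPolynomial S, ∀ i, n ≤ i → (f - q * G).coeff i = 0 := by
    intro N
    induction N with
    | zero => exact fun f hf => ⟨0, by simpa using hf⟩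
    | succ N ih =>
      intro f hf
      -- cancel the top term of `f` with a left multiple of `G`
      obtain ⟨q, hq⟩ := ih (f - monomial N (f.coeff (n + N)) * G) fun i hi => by
        rw [coeff_sub, coeff_monomial_mul, if_pos (by omega)]
        rcases hi.eq_or_lt with rfl | hi
        · rw [Nat.add_sub_cancel, hGn, iterate_map_one, mul_one, sub_self]
        · rw [hf i (by omega), hG _ (by omega), iterate_map_zero, mul_zero, sub_self]
      refine ⟨monomial N (f.coeff (n + N)) + q, fun i hi => ?_⟩
      rw [add_mul, ← sub_sub]
      exact hq i hi
  refine key (f.support.sup id + 1) f fun i hi => ?_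
  by_contra h
  have : i ≤ f.support.sup id := Finset.le_sup (f := id) (mem_support_iff.mpr h)
  omega

end Basic

end SkewPolynomial

/-! ### Presentation and reduction of Galois rings -/

open Polynomial in
/-- A Galois ring is generated over `ℤ` by a root `x` of an integral polynomial `F` that is
separable modulo `p`, and `x ↦ y` extends to a homomorphism into any ring `B` with `p ^ ν = 0` in
which `F y = 0`. Integral coefficients make these facts compatible with all ring homomorphisms. -/
theorem IsGaloisRing.exists_generator {p ν d : ℕ} {A : Type*} [CommRing A]
    (h : IsGaloisRing p ν d A) :
    ∃ (F : ℤ[X]) (x : A), aeval x F = 0 ∧ (F.map (Int.castRingHom (ZMod p))).Separable ∧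
      Algebra.adjoin ℤ {x} = ⊤ ∧
      ∀ (B : Type*) [CommRing B] (y : B), (p : B) ^ ν = 0 → aeval y F = 0 →
        ∃ ψ : A →+* B, ψ x = y := by
  obtain ⟨hp, hν, f, hmon, -, hirr, ⟨E⟩⟩ := h
  have := Fact.mk hp
  have hsurj : Function.Surjective (Int.castRingHom (ZMod (p ^ ν))) := ZMod.intCast_surjective
  obtain ⟨F, rfl⟩ := Polynomial.map_surjective _ hsurj f
  have hmap : (F.map (Int.castRingHom (ZMod (p ^ ν)))).map
      (ZMod.castHom (dvd_pow_self p hν) (ZMod p)) = F.map (Int.castRingHom (ZMod p)) := by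
    rw [Polynomial.map_map]
    congr 1
    exact RingHom.ext_int _ _
  rw [hmap] at hirr
  set I := Ideal.span {F.map (Int.castRingHom (ZMod (p ^ ν)))} with hI
  -- the evaluation map `ℤ[X] → A` at the class of `X` is the composite of three surjections
  let π : ℤ[X] →+* A := (E.symm : _ →+* A).comp
    ((Ideal.Quotient.mk I).comp (mapRingHom (Int.castRingHom (ZMod (p ^ ν)))))
  have hπ : ∀ P : ℤ[X], aeval (π X) P = π P := fun P => by
    have : (aeval (π X) : ℤ[X] →ₐ[ℤ] A) = π.toIntAlgHom :=
      Polynomial.algHom_ext (by rw [aeval_X]; rfl)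
    rw [this]; rfl
  refine ⟨F, π X, ?_, PerfectField.separable_of_irreducible hirr, ?_, ?_⟩
  · rw [hπ]
    simp only [π, RingHom.comp_apply, coe_mapRingHom]
    rw [Ideal.Quotient.eq_zero_iff_mem.mpr (Ideal.subset_span (Set.mem_singleton _)), map_zero]
  · rw [Algebra.adjoin_singleton_eq_range_aeval, eq_top_iff]
    rintro a -
    obtain ⟨b, hb⟩ := Ideal.Quotient.mk_surjective (E a)
    obtain ⟨P, rfl⟩ := Polynomial.map_surjective _ hsurj b
    refine ⟨P, (hπ P).trans (E.injective ?_)⟩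
    simpa [π] using hb
  · intro B _ y hpB hy
    let c : ZMod (p ^ ν) →+* B :=
      Ideal.Quotient.lift (Ideal.span {((p ^ ν : ℕ) : ℤ)}) (Int.castRingHom B) (by
        intro a ha
        obtain ⟨b, rfl⟩ := Ideal.mem_span_singleton'.mp ha
        simp [hpB]) |>.comp (Int.quotientSpanNatEquivZMod (p ^ ν)).symm.toRingHom
    have hc : c.comp (Int.castRingHom (ZMod (p ^ ν))) = Int.castRingHom B := RingHom.ext_int _ _
    refine ⟨(Ideal.Quotient.lift I (eval₂RingHom c y) ?_).comp (E : A →+* _), ?_⟩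
    · intro a ha
      obtain ⟨b, rfl⟩ := Ideal.mem_span_singleton'.mp ha
      rw [map_mul, coe_eval₂RingHom, eval₂_map, hc]
      rw [aeval_def] at hy
      erw [hy]
      simp
    · simp [π]

/-- The ideal `(p)` is the kernel of the reduction `A → 𝔽_p[x] / (f mod p)` onto a field. -/
theorem IsGaloisRing.isMaximal_span {p ν d : ℕ} {A : Type*} [CommRing A]
    (h : IsGaloisRing p ν d A) : (Ideal.span {(p : A)}).IsMaximal := by
  obtain ⟨hp, hν, f, hmon, -, hirr, ⟨E⟩⟩ := h
  have := Fact.mk hp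
  have := Fact.mk hirr
  set ρ := ZMod.castHom (dvd_pow_self p hν) (ZMod p)
  have hρs : Function.Surjective ρ := ZMod.castHom_surjective _
  let π : A →+* AdjoinRoot (f.map ρ) :=
    (Ideal.Quotient.lift (Ideal.span {f})
      ((AdjoinRoot.mk (f.map ρ)).comp (Polynomial.mapRingHom ρ)) (by
        intro a ha
        obtain ⟨b, rfl⟩ := Ideal.mem_span_singleton'.mp ha
        simp)).comp (E : A →+* _)
  have hπ : Function.Surjective π := by
    intro a
    obtain ⟨b, rfl⟩ := AdjoinRoot.mk_surjective a
    obtain ⟨P, rfl⟩ := Polynomial.map_surjective _ hρs b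
    exact ⟨E.symm (Ideal.Quotient.mk _ P), by simp [π]⟩
  have hker : RingHom.ker π = Ideal.span {(p : A)} := by
    apply le_antisymm
    · intro a ha
      obtain ⟨P, hP⟩ := Ideal.Quotient.mk_surjective (E a)
      have h0 : AdjoinRoot.mk (f.map ρ) (P.map ρ) = 0 := by
        have : π a = 0 := ha
        simpa [π, ← hP] using this
      obtain ⟨Q, hQ⟩ := AdjoinRoot.mk_eq_zero.mp h0
      obtain ⟨Q, rfl⟩ := Polynomial.map_surjective _ hρs Q
      have h1 : P - f * Q ∈ RingHom.ker (Polynomial.mapRingHom ρ) := by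
        rw [RingHom.mem_ker, Polynomial.coe_mapRingHom, Polynomial.map_sub, Polynomial.map_mul,
          hQ, sub_self]
      rw [Polynomial.ker_mapRingHom] at h1
      have h2 : RingHom.ker ρ = Ideal.span {(p : ZMod (p ^ ν))} := by
        refine le_antisymm (fun b hb => ?_) ?_
        · obtain ⟨z, rfl⟩ := ZMod.intCast_surjective b
          rw [RingHom.mem_ker, map_intCast, ZMod.intCast_zmod_eq_zero_iff_dvd] at hb
          obtain ⟨w, rfl⟩ := hb
          exact Ideal.mem_span_singleton.mpr ⟨w, by push_cast; rfl⟩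
        · simp [Ideal.span_le]
      rw [h2, Ideal.map_span, Set.image_singleton, Ideal.mem_span_singleton] at h1
      obtain ⟨T, hT⟩ := h1
      rw [Ideal.mem_span_singleton]
      refine ⟨E.symm (Ideal.Quotient.mk _ T), E.injective ?_⟩
      rw [map_mul, RingEquiv.apply_symm_apply, ← hP, sub_eq_iff_eq_add.mp hT, map_add]
      simp [Ideal.Quotient.eq_zero_iff_mem.mpr (Ideal.subset_span (Set.mem_singleton f))]
    · rw [Ideal.span_le, Set.singleton_subset_iff]
      have : ((p : ℕ) : AdjoinRoot (f.map ρ)) = 0 := by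
        rw [← map_natCast (AdjoinRoot.of (f.map ρ)), CharP.cast_eq_zero, map_zero]
      simp [this]
  rw [← hker]
  exact RingHom.ker_isMaximal_of_surjective π hπ

theorem IsGaloisRing.natCast_pow_eq_zero {p ν d : ℕ} {A : Type*} [CommRing A]
    (h : IsGaloisRing p ν d A) : (p : A) ^ ν = 0 := by
  obtain ⟨hp, hν, f, hmon, -, hirr, ⟨E⟩⟩ := h
  apply E.injective
  have h0 : ((p ^ ν : ℕ) : Polynomial (ZMod (p ^ ν))) = 0 := by
    rw [← map_natCast Polynomial.C, ZMod.natCast_self, map_zero]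
  rw [map_pow, map_natCast, map_zero, ← map_natCast (Ideal.Quotient.mk _), ← map_pow,
    ← Nat.cast_pow, h0, map_zero]

theorem IsGaloisRing.natCast_pow_sub_one_ne_zero {p ν d : ℕ} {A : Type*} [CommRing A]
    (h : IsGaloisRing p ν d A) : (p : A) ^ (ν - 1) ≠ 0 := by
  obtain ⟨hp, hν, f, hmon, -, hirr, ⟨E⟩⟩ := h
  have := Fact.mk hp
  intro h0
  -- a constant divisible by the monic polynomial `f` of positive degree is zero
  have h1 : Ideal.Quotient.mk (Ideal.span {f})
      (Polynomial.C (((p ^ (ν - 1) : ℕ) : ZMod (p ^ ν)))) = 0 := by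
    have := congrArg E h0
    rw [map_zero] at this
    rw [← this]
    simp
  have hN : 1 < p ^ ν := Nat.one_lt_pow hν hp.one_lt
  have := Fact.mk hN
  rw [Ideal.Quotient.eq_zero_iff_mem, Ideal.mem_span_singleton,
    ← Polynomial.modByMonic_eq_zero_iff_dvd hmon, (Polynomial.modByMonic_eq_self_iff hmon).mpr,
    Polynomial.C_eq_zero, ZMod.natCast_eq_zero_iff, Nat.pow_dvd_pow_iff_le_right hp.one_lt] at h1
  · omega
  · refine lt_of_le_of_lt Polynomial.degree_C_le ?_
    rw [← hmon.degree_map (ZMod.castHom (dvd_pow_self p hν) (ZMod p))]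
    exact hirr.degree_pos

theorem IsGaloisRing.finite {p ν d : ℕ} {A : Type*} [CommRing A]
    (h : IsGaloisRing p ν d A) : Finite A := by
  obtain ⟨hp, hν, f, hmon, -, hirr, ⟨E⟩⟩ := h
  have : NeZero (p ^ ν) := ⟨pow_ne_zero _ hp.ne_zero⟩
  have := hmon.finite_quotient
  have : Finite (Polynomial (ZMod (p ^ ν)) ⧸ Ideal.span {f}) :=
    Module.finite_of_finite (ZMod (p ^ ν))
  exact Finite.of_equiv _ E.symm.toEquiv

/-! ### Ideals of Galois rings and the lift of Frobenius -/

namespace IsGaloisRing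

variable {p ν d : ℕ} {A : Type*} [CommRing A]

theorem isLocalRing (h : IsGaloisRing p ν d A) : IsLocalRing A := by
  refine IsLocalRing.of_unique_max_ideal ⟨_, h.isMaximal_span, fun M hM => ?_⟩
  refine (h.isMaximal_span.eq_of_le hM.ne_top ?_).symm
  rw [Ideal.span_le, Set.singleton_subset_iff]
  exact hM.isPrime.mem_of_pow_mem ν (by rw [h.natCast_pow_eq_zero]; exact M.zero_mem)

theorem maximalIdeal_eq [IsLocalRing A] (h : IsGaloisRing p ν d A) :
    IsLocalRing.maximalIdeal A = Ideal.span {(p : A)} :=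
  (IsLocalRing.eq_maximalIdeal h.isMaximal_span).symm

theorem isNilpotent_of_mem_maximalIdeal [IsLocalRing A] (h : IsGaloisRing p ν d A) {a : A}
    (ha : a ∈ IsLocalRing.maximalIdeal A) : IsNilpotent a := by
  rw [h.maximalIdeal_eq, Ideal.mem_span_singleton] at ha
  obtain ⟨b, rfl⟩ := ha
  exact ⟨ν, by rw [mul_pow, h.natCast_pow_eq_zero, zero_mul]⟩

/-- Every nonzero element of a Galois ring is a power of `p` times a unit. -/
theorem exists_eq_mul_pow (h : IsGaloisRing p ν d A) {a : A} (ha : a ≠ 0) :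
    ∃ (c : A) (i : ℕ), IsUnit c ∧ i < ν ∧ a = (p : A) ^ i * c := by
  classical
  have := h.isLocalRing
  have hex : ∃ j, ¬ (p : A) ^ j ∣ a := ⟨ν, by rwa [h.natCast_pow_eq_zero, zero_dvd_iff]⟩
  obtain ⟨i, hi⟩ : ∃ i, Nat.find hex = i + 1 := Nat.exists_eq_succ_of_ne_zero fun h0 => by
    simpa [h0] using Nat.find_spec hex
  obtain ⟨c, hc⟩ := not_not.mp (Nat.find_min hex (m := i) (by omega))
  refine ⟨c, i, ?_, ?_, hc⟩
  · by_contra hcu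
    have hmem : c ∈ IsLocalRing.maximalIdeal A := hcu
    rw [h.maximalIdeal_eq, Ideal.mem_span_singleton] at hmem
    obtain ⟨b, rfl⟩ := hmem
    refine Nat.find_spec hex ⟨b, ?_⟩
    rw [hi, hc]; ring
  · have : Nat.find hex ≤ ν := Nat.find_min' hex (by rwa [h.natCast_pow_eq_zero, zero_dvd_iff])
    omega

/-- Every nonzero ideal contains `p ^ (ν - 1)`. -/
theorem dvd_natCast_pow (h : IsGaloisRing p ν d A) {a : A} (ha : a ≠ 0) :
    a ∣ (p : A) ^ (ν - 1) := by
  obtain ⟨c, i, hc, hi, rfl⟩ := h.exists_eq_mul_pow ha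
  exact hc.mul_right_dvd.mpr (pow_dvd_pow _ (by omega))

theorem natCast_pow_mul_eq_zero [IsLocalRing A] (h : IsGaloisRing p ν d A) {a : A}
    (ha : a ∈ IsLocalRing.maximalIdeal A) : (p : A) ^ (ν - 1) * a = 0 := by
  have hν := h.2.choose
  rw [h.maximalIdeal_eq, Ideal.mem_span_singleton] at ha
  obtain ⟨b, rfl⟩ := ha
  rw [← mul_assoc, ← pow_succ, Nat.sub_add_cancel (Nat.one_le_iff_ne_zero.mpr hν),
    h.natCast_pow_eq_zero, zero_mul]

theorem preValuationRing (h : IsGaloisRing p ν d A) : PreValuationRing A := by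
  refine ⟨fun a b => ?_⟩
  by_cases ha : a = 0
  · exact ⟨0, Or.inr (by simp [ha])⟩
  by_cases hb : b = 0
  · exact ⟨0, Or.inl (by simp [hb])⟩
  obtain ⟨c, i, hc, -, rfl⟩ := h.exists_eq_mul_pow ha
  obtain ⟨c', j, hc', -, rfl⟩ := h.exists_eq_mul_pow hb
  rcases le_total i j with hij | hij
  · obtain ⟨w, hw⟩ := hc.mul_right_dvd.mpr ((pow_dvd_pow (p : A) hij).mul_right c')
    exact ⟨w, Or.inl hw.symm⟩
  · obtain ⟨w, hw⟩ := hc'.mul_right_dvd.mpr ((pow_dvd_pow (p : A) hij).mul_right c)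
    exact ⟨w, Or.inr hw.symm⟩

open IsLocalRing

theorem charP_residueField [IsLocalRing A] (h : IsGaloisRing p ν d A) :
    CharP (ResidueField A) p := by
  have h0 : (p : ResidueField A) = 0 := by
    rw [← map_natCast (residue A), residue_eq_zero_iff, h.maximalIdeal_eq]
    exact Ideal.mem_span_singleton_self _
  have := Fact.mk h.1
  exact (CharP.charP_iff_prime_eq_zero h.1).mpr h0

end IsGaloisRing

section FrobeniusLift

open IsLocalRing Polynomial

theorem map_aeval_int {A B : Type*} [CommRing A] [CommRing B] (ψ : A →+* B) (F : ℤ[X]) (x : A) :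
    ψ (aeval x F) = aeval (ψ x) F :=
  (Polynomial.aeval_algHom_apply ψ.toIntAlgHom x F).symm

theorem RingHom.eq_of_adjoin_singleton_eq_top {A B : Type*} [CommRing A] [CommRing B] {x : A}
    (hx : Algebra.adjoin ℤ {x} = ⊤) {ψ ψ' : A →+* B} (h : ψ x = ψ' x) : ψ = ψ' := by
  have : ψ.toIntAlgHom = ψ'.toIntAlgHom :=
    AlgHom.ext_of_adjoin_eq_top hx (by rintro _ rfl; exact h)
  ext a
  exact DFunLike.congr_fun this a

variable {R S : Type*} [CommRing R] [CommRing S] {p ν d m : ℕ}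

theorem IsGaloisRing.isUnit_aeval_derivative [IsLocalRing S] (hS : IsGaloisRing p ν d S)
    {F : ℤ[X]} (hF : (F.map (Int.castRingHom (ZMod p))).Separable) {y : S}
    (hy : aeval y F ∈ maximalIdeal S) : IsUnit (aeval y (derivative F)) := by
  have := hS.charP_residueField
  have hc : ∀ P : ℤ[X], residue S (aeval y P) =
      (P.map (Int.castRingHom (ZMod p))).eval₂ (ZMod.castHom dvd_rfl (ResidueField S))
        (residue S y) := fun P => by
    rw [map_aeval_int, eval₂_map, aeval_def]
    congr 1
    exact RingHom.ext_int _ _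
  rw [← residue_eq_zero_iff, hc] at hy
  rw [← residue_ne_zero_iff_isUnit, hc, ← derivative_map]
  exact hF.eval₂_derivative_ne_zero _ hy

/-- Galois rings are rigid over their residue fields: homomorphisms out of one that agree modulo
`p` are equal. -/
theorem IsGaloisRing.ringHom_eq_of_residue [IsLocalRing S] {d' : ℕ} (hR : IsGaloisRing p ν d' R)
    (hS : IsGaloisRing p ν d S)
    {ψ ψ' : R →+* S} (h : ∀ a, residue S (ψ a) = residue S (ψ' a)) : ψ = ψ' := by
  obtain ⟨F, x, hx, hF, htop, -⟩ := IsGaloisRing.exists_generator.{_, 0} hR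
  have hψ : ∀ χ : R →+* S, aeval (χ x) F = 0 := fun χ => by rw [← map_aeval_int, hx, map_zero]
  refine RingHom.eq_of_adjoin_singleton_eq_top htop ?_
  refine (existsUnique_nilpotent_sub_and_aeval_eq_zero (x := ψ x) (P := F) ?_ ?_).unique
    ⟨?_, hψ ψ⟩ ⟨?_, hψ ψ'⟩
  · rw [hψ]; exact IsNilpotent.zero
  · exact hS.isUnit_aeval_derivative hF (by rw [hψ]; exact Submodule.zero_mem _)
  · rw [sub_self]; exact IsNilpotent.zero
  · refine hS.isNilpotent_of_mem_maximalIdeal ?_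
    rw [← residue_eq_zero_iff, map_sub, h, sub_self]

/-- Every homomorphism from a Galois ring to the residue field of a Galois ring lifts. -/
theorem IsGaloisRing.exists_ringHom_lift [IsLocalRing S] {d' : ℕ} (hR : IsGaloisRing p ν d' R)
    (hS : IsGaloisRing p ν d S) (χ : R →+* ResidueField S) :
    ∃ ψ : R →+* S, ∀ a, residue S (ψ a) = χ a := by
  obtain ⟨F, x, hx, hF, htop, hlift⟩ := hR.exists_generator
  obtain ⟨y₀, hy₀⟩ := residue_surjective (χ x)
  have h0 : aeval y₀ F ∈ maximalIdeal S := by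
    rw [← residue_eq_zero_iff, map_aeval_int, hy₀, ← map_aeval_int, hx, map_zero]
  obtain ⟨y, ⟨hy, hyF⟩, -⟩ := existsUnique_nilpotent_sub_and_aeval_eq_zero
    (hS.isNilpotent_of_mem_maximalIdeal h0) (hS.isUnit_aeval_derivative hF h0)
  obtain ⟨ψ, hψ⟩ := hlift S y hS.natCast_pow_eq_zero hyF
  refine ⟨ψ, fun a => ?_⟩
  have : (residue S).comp ψ = χ := by
    refine RingHom.eq_of_adjoin_singleton_eq_top htop ?_
    rw [RingHom.comp_apply, hψ, ← hy₀]
    have := (hy.map (residue S)).eq_zero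
    rw [map_sub, sub_eq_zero] at this
    exact this.symm
  exact DFunLike.congr_fun this a

/-- The residue field of a Galois extension of Galois rings: every class fixed by a generator of
the Galois group comes from the base ring. The reason is that the Frobenius of the residue
extension lifts to an automorphism over the base ring. -/
theorem IsGaloisRing.exists_residue_eq_of_fixed [IsLocalRing R] [IsLocalRing S] [Algebra R S]
    {d' : ℕ} (hR : IsGaloisRing p ν d' R) (hS : IsGaloisRing p ν d S) (σ : S ≃ₐ[R] S)
    (hσ : ∀ τ : S ≃ₐ[R] S, τ ∈ Subgroup.zpowers σ) {a : S}
    (ha : residue S (σ a) = residue S a) :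
    ∃ r : R, residue S (algebraMap R S r) = residue S a := by
  have := hS.finite
  have := hR.finite
  have := Fact.mk hR.1
  have := hR.charP_residueField
  have := hS.charP_residueField
  have : IsLocalHom (algebraMap R S) := ⟨fun r hr => by
    by_contra hu
    exact ((hR.isNilpotent_of_mem_maximalIdeal hu).map (algebraMap R S)).not_isUnit hr⟩
  have : Finite (ResidueField R) := Finite.of_surjective _ residue_surjective
  have : Finite (ResidueField S) := Finite.of_surjective _ residue_surjective
  let _ := Fintype.ofFinite (ResidueField R)
  obtain ⟨j, -, hj⟩ := FiniteField.card (ResidueField R) p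
  -- the relative Frobenius of the residue fields lifts to `ψ : S →+* S`
  obtain ⟨ψ, hψ⟩ := hS.exists_ringHom_lift hS
    ((iterateFrobenius (ResidueField S) p j).comp (residue S))
  have hψR : ψ.comp (algebraMap R S) = algebraMap R S := by
    refine hR.ringHom_eq_of_residue hS fun r => ?_
    rw [RingHom.comp_apply, hψ, RingHom.comp_apply, iterateFrobenius_def, ← hj,
      ← ResidueField.algebraMap_residue, ← map_pow, FiniteField.pow_card]
  have hinj : Function.Injective ψ := by
    rw [injective_iff_map_eq_zero]
    intro b hb
    -- a nonzero kernel would contain `p ^ (ν - 1)`, which every ring homomorphism fixes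
    by_contra hb0
    obtain ⟨c, hc⟩ := hS.dvd_natCast_pow hb0
    refine hS.natCast_pow_sub_one_ne_zero ?_
    rw [← map_natCast ψ, ← map_pow, hc, map_mul, hb, zero_mul]
  let ψ' : S →ₐ[R] S := { ψ with commutes' := fun r => DFunLike.congr_fun hψR r }
  let τ : S ≃ₐ[R] S := AlgEquiv.ofBijective ψ' (Finite.injective_iff_bijective.mp hinj)
  -- `a` is fixed modulo `p` by all powers of `σ`, hence by the lift of Frobenius
  have : Finite (S ≃ₐ[R] S) := Finite.of_injective _ DFunLike.coe_injective
  obtain ⟨l, hl⟩ := mem_powers_iff_mem_zpowers.mpr (hσ τ)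
  have hpow : ∀ l : ℕ, residue S ((σ ^ l) a) = residue S a := by
    intro l
    induction l with
    | zero => rfl
    | succ l ih =>
      have h1 : residue S (σ ((σ ^ l) a)) = residue S (σ a) := by
        have := (ResidueField.mapEquiv (σ : S ≃+* S)).congr_arg ih
        exact this
      rw [pow_succ', AlgEquiv.mul_apply, h1, ha]
  have hfix : (residue S a) ^ Fintype.card (ResidueField R) = residue S a := by
    have h1 : residue S (τ a) = (residue S a) ^ Fintype.card (ResidueField R) := by
      rw [hj, ← iterateFrobenius_def]
      exact hψ a
    rw [← h1, ← hpow l]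
    exact congrArg _ (DFunLike.congr_fun hl a).symm
  obtain ⟨r, hr⟩ : ∃ r : ResidueField R, algebraMap _ (ResidueField S) r = residue S a := by
    -- with `q` the order of the residue field of `R`, `X ^ q - X` already splits over that field
    have hroots := FiniteField.roots_X_pow_card_sub_X (ResidueField R)
    have hsplit : Splits (X ^ Fintype.card (ResidueField R) - X : (ResidueField R)[X]) := by
      rw [splits_iff_card_roots, hroots, ← Finset.card_def, Finset.card_univ,
        FiniteField.X_pow_card_sub_X_natDegree_eq _ Fintype.one_lt_card]
    have hmem := hsplit.roots_map (algebraMap (ResidueField R) (ResidueField S))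
    rw [hroots] at hmem
    have hin : residue S a ∈ ((X ^ Fintype.card (ResidueField R) - X : (ResidueField R)[X]).map
        (algebraMap (ResidueField R) (ResidueField S))).roots := by
      rw [mem_roots ((Polynomial.map_ne_zero_iff
        (algebraMap (ResidueField R) (ResidueField S)).injective).mpr
        (FiniteField.X_pow_card_sub_X_ne_zero _ Fintype.one_lt_card))]
      simp [hfix]
    rw [hmem, Multiset.mem_map] at hin
    exact hin.imp fun r hr => hr.2
  obtain ⟨r, rfl⟩ := residue_surjective r
  exact ⟨r, by rw [← hr, ResidueField.algebraMap_residue]⟩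

end FrobeniusLift

/-! ### Smith normal forms -/

section SmithExistence

open Matrix

variable {A : Type*} [CommRing A]

theorem exists_forall_dvd [PreValuationRing A] {ι : Type*} [Finite ι] [Nonempty ι] (x : ι → A) :
    ∃ i, ∀ j, x i ∣ x j := by
  classical
  have := Fintype.ofFinite ι
  have key : ∀ s : Finset ι, s.Nonempty → ∃ i, ∀ j ∈ s, x i ∣ x j := by
    intro s hs
    induction hs using Finset.Nonempty.cons_induction with
    | singleton a => exact ⟨a, by simp⟩
    | cons a s ha hs ih =>
      obtain ⟨i, hi⟩ := ih
      obtain ⟨c, hc | hc⟩ := PreValuationRing.cond (x a) (x i)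
      · exact ⟨a, fun j hj => by
          rcases Finset.mem_cons.mp hj with rfl | hj
          · rfl
          · exact (Dvd.intro c hc).trans (hi j hj)⟩
      · exact ⟨i, fun j hj => by
          rcases Finset.mem_cons.mp hj with rfl | hj
          · exact Dvd.intro c hc
          · exact hi j hj⟩
  obtain ⟨i, hi⟩ := key Finset.univ Finset.univ_nonempty
  exact ⟨i, fun j => hi j (Finset.mem_univ j)⟩

/-- The block diagonal matrix with the blocks `c` and `M`. -/
def consDiag {a b : ℕ} (c : A) (M : Matrix (Fin a) (Fin b) A) :
    Matrix (Fin (a + 1)) (Fin (b + 1)) A :=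
  Matrix.of (Fin.cons (Fin.cons c 0) fun i => Fin.cons 0 (M i))

theorem consDiag_mul {a b l : ℕ} (c c' : A) (M : Matrix (Fin a) (Fin b) A)
    (M' : Matrix (Fin b) (Fin l) A) :
    consDiag c M * consDiag c' M' = consDiag (c * c') (M * M') := by
  ext i j
  refine Fin.cases ?_ (fun i => ?_) i <;> refine Fin.cases ?_ (fun j => ?_) j <;>
    simp [consDiag, Matrix.mul_apply, Fin.sum_univ_succ]

theorem consDiag_one {a : ℕ} : consDiag (1 : A) (1 : Matrix (Fin a) (Fin a) A) = 1 := by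
  ext i j
  refine Fin.cases ?_ (fun i => ?_) i <;> refine Fin.cases ?_ (fun j => ?_) j <;>
    simp [consDiag, Matrix.one_apply, Fin.succ_ne_zero, (Fin.succ_ne_zero _).symm]

theorem isUnit_consDiag {a : ℕ} {P : Matrix (Fin a) (Fin a) A} (hP : IsUnit P) :
    IsUnit (consDiag 1 P) := by
  obtain ⟨Q, hPQ, hQP⟩ := isUnit_iff_exists.mp hP
  exact isUnit_iff_exists.mpr ⟨consDiag 1 Q, by rw [consDiag_mul, hPQ, one_mul, consDiag_one],
    by rw [consDiag_mul, hQP, one_mul, consDiag_one]⟩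

/-- The unipotent matrix that adds `x i` times the first row to the row `i + 1`. -/
def shear {a : ℕ} (x : Fin a → A) : Matrix (Fin (a + 1)) (Fin (a + 1)) A :=
  Matrix.of (Fin.cons (Fin.cons 1 0) fun i => Fin.cons (x i) ((1 : Matrix (Fin a) (Fin a) A) i))

theorem shear_mul_shear {a : ℕ} (x y : Fin a → A) : shear x * shear y = shear (x + y) := by
  ext i j
  refine Fin.cases ?_ (fun i => ?_) i <;> refine Fin.cases ?_ (fun j => ?_) j <;>
    simp [shear, Matrix.mul_apply, Fin.sum_univ_succ, Matrix.one_apply]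

theorem shear_zero {a : ℕ} : shear (0 : Fin a → A) = 1 := by
  ext i j
  refine Fin.cases ?_ (fun i => ?_) i <;> refine Fin.cases ?_ (fun j => ?_) j <;>
    simp [shear, Matrix.one_apply, Fin.succ_ne_zero, (Fin.succ_ne_zero _).symm]

theorem isUnit_shear {a : ℕ} (x : Fin a → A) : IsUnit (shear x) :=
  isUnit_iff_exists.mpr ⟨shear (-x), by rw [shear_mul_shear, add_neg_cancel, shear_zero],
    by rw [shear_mul_shear, neg_add_cancel, shear_zero]⟩

theorem isUnit_swap_toMatrix {a : ℕ} (i j : Fin a) :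
    IsUnit ((Equiv.swap i j).toPEquiv.toMatrix : Matrix (Fin a) (Fin a) A) := by
  rw [Matrix.isUnit_iff_isUnit_det, Matrix.det_permutation]
  exact ((Equiv.Perm.sign (Equiv.swap i j)).isUnit).map (Int.castRingHom A)

/-- A matrix whose corner divides its first row and its first column can be cleared by row and
column operations. -/
theorem exists_mul_mul_eq_consDiag {a b : ℕ} (M : Matrix (Fin (a + 1)) (Fin (b + 1)) A)
    (x : Fin a → A) (y : Fin b → A) (hx : ∀ i, M i.succ 0 = M 0 0 * x i)
    (hy : ∀ j, M 0 j.succ = M 0 0 * y j) :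
    ∃ (P : Matrix (Fin (a + 1)) (Fin (a + 1)) A) (Q : Matrix (Fin (b + 1)) (Fin (b + 1)) A),
      IsUnit P ∧ IsUnit Q ∧ P * M * Q = consDiag (M 0 0)
        (Matrix.of fun i j => M i.succ j.succ - M 0 0 * x i * y j) := by
  refine ⟨shear (-x), (shear (-y))ᵀ, isUnit_shear _, ?_, ?_⟩
  · rw [Matrix.isUnit_iff_isUnit_det, Matrix.det_transpose, ← Matrix.isUnit_iff_isUnit_det]
    exact isUnit_shear _
  ext i j
  refine Fin.cases ?_ (fun i => ?_) i <;> refine Fin.cases ?_ (fun j => ?_) j <;>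
    simp [consDiag, shear, Matrix.mul_apply, Fin.sum_univ_succ, Matrix.one_apply, hx, hy] <;> ring

/-- Over a ring whose principal ideals form a chain, pivoting on an entry that divides all the
others produces a Smith normal form. -/
theorem exists_smith [PreValuationRing A] : ∀ {a b : ℕ} (M : Matrix (Fin a) (Fin b) A),
    ∃ (P : Matrix (Fin a) (Fin a) A) (Q : Matrix (Fin b) (Fin b) A) (D : Matrix (Fin a) (Fin b) A),
      IsUnit P ∧ IsUnit Q ∧ D = P * M * Q ∧
      (∀ (i : Fin a) (j : Fin b), (i : ℕ) ≠ (j : ℕ) → D i j = 0) ∧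
      ∀ l l' : Fin (min a b), l ≤ l' → rectDiag D l ∣ rectDiag D l'
  | 0, b, M => ⟨1, 1, M, isUnit_one, isUnit_one, by simp, fun i => i.elim0,
      fun l => absurd l.2 (by simp)⟩
  | a + 1, 0, M => ⟨1, 1, M, isUnit_one, isUnit_one, by simp, fun _ j => j.elim0,
      fun l => absurd l.2 (by simp)⟩
  | a + 1, b + 1, M => by
    -- move an entry that divides all the others into the corner
    obtain ⟨⟨i₀, j₀⟩, h₀⟩ := exists_forall_dvd fun ij : Fin (a + 1) × Fin (b + 1) => M ij.1 ij.2
    let M₁ : Matrix (Fin (a + 1)) (Fin (b + 1)) A :=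
      M.submatrix (Equiv.swap 0 i₀) (Equiv.swap 0 j₀)
    have hM₁ : M₁ = ((Equiv.swap 0 i₀).toPEquiv.toMatrix : Matrix _ _ A) * M *
        ((Equiv.swap 0 j₀).toPEquiv.toMatrix : Matrix _ _ A) := by
      rw [PEquiv.toMatrix_toPEquiv_mul, PEquiv.mul_toMatrix_toPEquiv, Matrix.submatrix_submatrix]
      rfl
    have hdvd : ∀ i j, M₁ 0 0 ∣ M₁ i j := fun i j => by
      simpa [M₁] using h₀ (_, _)
    choose x hx using fun i : Fin a => hdvd i.succ 0
    choose y hy using fun j : Fin b => hdvd 0 j.succ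
    obtain ⟨P₁, Q₁, hP₁, hQ₁, h₁⟩ := exists_mul_mul_eq_consDiag M₁ x y hx hy
    set M₂ : Matrix (Fin a) (Fin b) A :=
      Matrix.of fun i j => M₁ i.succ j.succ - M₁ 0 0 * x i * y j with hM₂
    obtain ⟨P₂, Q₂, D, hP₂, hQ₂, hD, hdiag, hchain⟩ := exists_smith M₂
    have hDdvd : ∀ i j, M₁ 0 0 ∣ D i j := fun i j => by
      rw [hD, Matrix.mul_apply]
      refine Finset.dvd_sum fun l _ => Dvd.dvd.mul_right ?_ _
      rw [Matrix.mul_apply]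
      refine Finset.dvd_sum fun l' _ => Dvd.dvd.mul_left ?_ _
      exact dvd_sub (hdvd _ _) ((Dvd.intro _ rfl).mul_right _)
    refine ⟨consDiag 1 P₂ * P₁ * (Equiv.swap 0 i₀).toPEquiv.toMatrix,
      (Equiv.swap 0 j₀).toPEquiv.toMatrix * Q₁ * consDiag 1 Q₂,
      consDiag (M₁ 0 0) D, ?_, ?_, ?_, ?_, ?_⟩
    · exact ((isUnit_consDiag hP₂).mul hP₁).mul (isUnit_swap_toMatrix _ _)
    · exact ((isUnit_swap_toMatrix _ _).mul hQ₁).mul (isUnit_consDiag hQ₂)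
    · calc consDiag (M₁ 0 0) D = consDiag 1 P₂ * consDiag (M₁ 0 0) M₂ * consDiag 1 Q₂ := by
            rw [consDiag_mul, consDiag_mul, one_mul, mul_one, hD]
        _ = _ := by rw [← h₁, hM₁]; simp only [Matrix.mul_assoc]
    · intro i j
      refine Fin.cases ?_ (fun i => ?_) i <;> refine Fin.cases ?_ (fun j => ?_) j <;>
        simp [consDiag]
      exact hdiag i j
    · rintro ⟨l, hl⟩ ⟨l', hl'⟩ hll
      rcases l' with _ | l' <;> rcases l with _ | l
      · rfl
      · exact absurd hll (by simp)
      · exact hDdvd ⟨l', by omega⟩ ⟨l', by omega⟩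
      · exact hchain ⟨l, by omega⟩ ⟨l', by omega⟩ (by simpa using hll)

theorem exists_isSmithNormalForm [PreValuationRing A] {a b : ℕ} (M : Matrix (Fin a) (Fin b) A) :
    ∃ D, IsSmithNormalForm M D := by
  obtain ⟨P, Q, D, hP, hQ, hD, hdiag, hchain⟩ := exists_smith M
  exact ⟨D, ⟨hP.unit, hQ.unit, hD⟩, hdiag, hchain⟩

/-- A matrix of rank `t` is `U * diag(δ) * V` with all `δ l ≠ 0`, where `U : a × t` has a left
inverse and `V : t × b` has a right inverse. -/
theorem exists_rank_factorization [PreValuationRing A] {a b : ℕ} (M : Matrix (Fin a) (Fin b) A) :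
    ∃ (U : Matrix (Fin a) (Fin (smithRank M)) A) (U' : Matrix (Fin (smithRank M)) (Fin a) A)
      (δ : Fin (smithRank M) → A) (V : Matrix (Fin (smithRank M)) (Fin b) A)
      (V' : Matrix (Fin b) (Fin (smithRank M)) A),
      U' * U = 1 ∧ V * V' = 1 ∧ (∀ l, δ l ≠ 0) ∧ M = U * Matrix.diagonal δ * V := by
  -- `smithRank` is an infimum of natural numbers, attained because a Smith normal form exists
  have hne : {t : ℕ | ∃ D, IsSmithNormalForm M D ∧ t = {l | rectDiag D l ≠ 0}.ncard}.Nonempty := by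
    obtain ⟨D, hD⟩ := exists_isSmithNormalForm M
    exact ⟨_, D, hD, rfl⟩
  obtain ⟨D, ⟨⟨P, Q, hPQ⟩, hdiag, -⟩, ht⟩ := Nat.sInf_mem hne
  change smithRank M = _ at ht
  -- enumerate the nonzero diagonal entries
  obtain ⟨f⟩ : Nonempty (Fin (smithRank M) ≃ {l | rectDiag D l ≠ 0}) := by
    rw [ht]
    exact ⟨(Finite.equivFinOfCardEq rfl).symm⟩
  let r : Fin (smithRank M) → Fin a := fun l => Fin.castLE (min_le_left a b) (f l)
  let c : Fin (smithRank M) → Fin b := fun l => Fin.castLE (min_le_right a b) (f l)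
  have hr : Function.Injective r := fun l l' h =>
    f.injective (Subtype.ext (Fin.castLE_injective _ h))
  have hc : Function.Injective c := fun l l' h =>
    f.injective (Subtype.ext (Fin.castLE_injective _ h))
  refine ⟨(P⁻¹ : GL (Fin a) A).1.submatrix id r, P.1.submatrix r id, fun l => rectDiag D (f l),
    (Q⁻¹ : GL (Fin b) A).1.submatrix c id, Q.1.submatrix id c, ?_, ?_, fun l => (f l).2, ?_⟩
  · rw [← Matrix.submatrix_mul _ _ _ _ _ Function.bijective_id, Units.mul_inv,
      Matrix.submatrix_one _ hr]
  · rw [← Matrix.submatrix_mul _ _ _ _ _ Function.bijective_id, Units.inv_mul,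
      Matrix.submatrix_one _ hc]
  · have hD : D = (1 : Matrix (Fin a) (Fin a) A).submatrix id r *
        Matrix.diagonal (fun l => rectDiag D (f l)) *
        (1 : Matrix (Fin b) (Fin b) A).submatrix c id := by
      ext i j
      rw [Matrix.mul_apply]
      simp only [Matrix.mul_diagonal, Matrix.submatrix_apply, id, Matrix.one_apply, ite_mul,
        one_mul, zero_mul, mul_ite, mul_one, mul_zero]
      by_cases h : ∃ l, r l = i ∧ c l = j
      · obtain ⟨l, rfl, rfl⟩ := h
        rw [Finset.sum_eq_single l]
        · simp [rectDiag, r, c]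
        · intro l' _ hl'
          rw [if_neg fun h => hl' (hc h)]
        · simp
      · rw [Finset.sum_eq_zero]
        · by_contra h0
          have hij : (i : ℕ) = j := not_not.mp fun hij => h0 (hdiag i j hij)
          let v : Fin (min a b) := ⟨i, lt_min i.2 (hij ▸ j.2)⟩
          have hv : rectDiag D v ≠ 0 := by
            have : rectDiag D v = D i j := congrArg (D i) (Fin.ext hij)
            rwa [this]
          refine h ⟨f.symm ⟨v, hv⟩, ?_, ?_⟩
          · simp [r, v]
          · simp [c, v, hij]
        · intro l _
          split_ifs with h1 h2
          · exact absurd ⟨l, h2.symm, h1⟩ h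
          all_goals rfl
    have hM : M = (P⁻¹ : GL (Fin a) A).1 * D * (Q⁻¹ : GL (Fin b) A).1 := by
      rw [hPQ, ← Matrix.mul_assoc, ← Matrix.mul_assoc, Units.inv_mul, Matrix.one_mul,
        Matrix.mul_assoc, Units.mul_inv, Matrix.mul_one]
    have hU : (P⁻¹ : GL (Fin a) A).1 * (1 : Matrix (Fin a) (Fin a) A).submatrix id r =
        (P⁻¹ : GL (Fin a) A).1.submatrix id r := Matrix.mul_submatrix_one (Equiv.refl _) r _
    have hV : (1 : Matrix (Fin b) (Fin b) A).submatrix c id * (Q⁻¹ : GL (Fin b) A).1 =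
        (Q⁻¹ : GL (Fin b) A).1.submatrix c id := Matrix.one_submatrix_mul c (Equiv.refl _) _
    rw [← hU, ← hV]
    conv_lhs => rw [hM, hD]
    simp only [Matrix.mul_assoc]

end SmithExistence

/-! ### Moore matrices -/

section Moore

open Matrix SkewPolynomial IsLocalRing

/-- Artin's argument: if `∑ j, φ^i (g j) * a j = 0` for `#s` consecutive exponents `i` and the `g j`
are linearly independent over the fixed field of `φ`, then `a = 0`. -/
theorem eq_zero_of_sum_iterate_mul_eq_zero {K ι : Type*} [Field K] (φ : K →+* K) (g : ι → K)
    (s : Finset ι)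
    (hg : ∀ a : ι → K, (∀ j ∈ s, φ (a j) = a j) → ∑ j ∈ s, g j * a j = 0 → ∀ j ∈ s, a j = 0)
    (a : ι → K) (ha : ∀ i < s.card, ∑ j ∈ s, φ^[i] (g j) * a j = 0) :
    ∀ j ∈ s, a j = 0 := by
  classical
  induction s using Finset.induction_on generalizing g a with
  | empty => simp
  | insert j₀ s hj₀ ih =>
    have hg' : ∀ a : ι → K, (∀ j ∈ s, φ (a j) = a j) → ∑ j ∈ s, g j * a j = 0 →
        ∀ j ∈ s, a j = 0 := by
      intro a hfix hsum j hj
      have hne : ∀ j ∈ s, j ≠ j₀ := fun j hj h => hj₀ (h ▸ hj)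
      have := hg (fun j => if j = j₀ then 0 else a j) (fun j hj => ?_) ?_ j (by simp [hj])
      · simpa [hne j hj] using this
      · rcases Finset.mem_insert.mp hj with rfl | hj
        · simp
        · simp [hne j hj, hfix j hj]
      · rw [Finset.sum_insert hj₀, if_pos rfl, mul_zero, zero_add, ← hsum]
        exact Finset.sum_congr rfl fun j hj => by rw [if_neg (hne j hj)]
    rw [Finset.card_insert_of_notMem hj₀] at ha
    -- it suffices to show that the coefficient at `j₀` vanishes
    suffices h0 : a j₀ = 0 by
      intro j hj
      rcases Finset.mem_insert.mp hj with rfl | hj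
      · exact h0
      · refine ih g hg' a (fun i hi => ?_) j hj
        have := ha i (by omega)
        rwa [Finset.sum_insert hj₀, h0, mul_zero, zero_add] at this
    by_contra h0
    -- normalise the coefficient at `j₀` to `1`; then `b - φ b` is a shorter relation
    let b : ι → K := fun j => a j / a j₀
    have hb : ∀ i < s.card + 1, ∑ j ∈ insert j₀ s, φ^[i] (g j) * b j = 0 := fun i hi => by
      simp only [b, mul_div_assoc', ← Finset.sum_div, ha i hi, zero_div]
    have hbj₀ : b j₀ = 1 := div_self h0
    -- the induction hypothesis applies to the family `φ (g j)`, which is again independent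
    have hfix : ∀ j ∈ s, b j - φ (b j) = 0 := by
      refine ih (fun j => φ (g j)) (fun c hc hsum => hg' c hc ?_) (fun j => b j - φ (b j)) ?_
      · refine φ.injective ?_
        rw [map_sum, map_zero, ← hsum]
        exact Finset.sum_congr rfl fun j hj => by rw [map_mul, hc j hj]
      · intro i hi
        have h1 := hb (i + 1) (by omega)
        have h2 := congrArg φ (hb i (by omega))
        rw [map_sum, map_zero] at h2
        have h3 := sub_eq_zero.mpr (h1.trans h2.symm)
        rw [← Finset.sum_sub_distrib, Finset.sum_insert hj₀, hbj₀, map_mul, map_one,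
          Function.iterate_succ_apply', sub_self, zero_add] at h3
        rw [← h3]
        refine Finset.sum_congr rfl fun j _ => ?_
        rw [map_mul, ← Function.iterate_succ_apply' φ, ← mul_sub, Function.iterate_succ_apply]
    have := hg b (fun j hj => ?_) (by simpa using hb 0 (by omega)) j₀ (Finset.mem_insert_self _ _)
    · rw [hbj₀] at this
      exact one_ne_zero this
    · rcases Finset.mem_insert.mp hj with rfl | hj
      · rw [hbj₀, map_one]
      · exact (sub_eq_zero.mp (hfix j hj)).symm

/-- The Moore matrix of a linearly independent family is invertible. -/
theorem isUnit_det_mooreMatrix {R S : Type*} [CommRing R] [CommRing S] [Algebra R S]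
    {p ν d d' : ℕ} (hR : IsGaloisRing p ν d R) (hS : IsGaloisRing p ν d' S)
    (σ : S ≃ₐ[R] S) (hσ : ∀ τ : S ≃ₐ[R] S, τ ∈ Subgroup.zpowers σ)
    [MulSemiringAction (Multiplicative ℕ) S] (hφ : ∀ a : S, φ a = σ a)
    {n : ℕ} {g : Fin n → S} (hg : LinearIndependent R g) : IsUnit (mooreMatrix n g).det := by
  have := hR.isLocalRing
  have := hS.isLocalRing
  by_contra hdet
  rw [← residue_ne_zero_iff_isUnit, not_not, RingHom.map_det] at hdet
  obtain ⟨v, hv0, hv⟩ := Matrix.exists_mulVec_eq_zero_iff.mpr hdet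
  let φK : ResidueField S →+* ResidueField S := ResidueField.mapEquiv (σ : S ≃+* S)
  have hφK : ∀ (i : ℕ) (a : S), residue S (φ^[i] a) = φK^[i] (residue S a) := by
    intro i a
    induction i with
    | zero => rfl
    | succ i ih =>
      rw [Function.iterate_succ_apply', Function.iterate_succ_apply', ← ih, hφ]
      rfl
  refine hv0 (funext fun j => eq_zero_of_sum_iterate_mul_eq_zero φK (fun j => residue S (g j))
    Finset.univ (fun a hfix hsum => ?_) v (fun i hi => ?_) j (Finset.mem_univ j))
  · -- the classes fixed by `φK` come from `R`, over which the family is independent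
    have hex : ∀ j, ∃ r : R, residue S (algebraMap R S r) = a j := fun j => by
      obtain ⟨b, hb⟩ := residue_surjective (a j)
      rw [← hb]
      refine hR.exists_residue_eq_of_fixed hS σ hσ ?_
      have := hfix j (Finset.mem_univ j)
      rw [← hb] at this
      exact this
    choose r hr using hex
    have hmem : ∑ j, r j • g j ∈ maximalIdeal S := by
      rw [← residue_eq_zero_iff, map_sum, ← hsum]
      exact Finset.sum_congr rfl fun j _ => by rw [Algebra.smul_def, map_mul, hr, mul_comm]
    -- multiplication by `p ^ (ν - 1)` turns a relation modulo `p` into a relation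
    have h0 : ∑ j, ((p : R) ^ (ν - 1) * r j) • g j = 0 := by
      simp only [mul_smul, ← Finset.smul_sum]
      rw [Algebra.smul_def, map_pow, map_natCast, hS.natCast_pow_mul_eq_zero hmem]
    have h1 := Fintype.linearIndependent_iff.mp hg _ h0
    intro j _
    rw [← hr]
    by_contra hne
    have hu : IsUnit (r j) := by
      by_contra hu
      refine hne ?_
      have hnil := (hR.isNilpotent_of_mem_maximalIdeal hu).map
        ((residue S).comp (algebraMap R S))
      exact hnil.eq_zero
    exact hR.natCast_pow_sub_one_ne_zero ((hu.mul_left_eq_zero).mp (h1 j))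
  · rw [Finset.card_univ, Fintype.card_fin] at hi
    have := congrFun hv ⟨i, hi⟩
    simpa [Matrix.mulVec, dotProduct, mooreMatrix, hφK] using this

end Moore

/-! ### Rank decompositions, interpolation and annihilators -/

section RankDecomposition

open Matrix

variable {R S : Type*} [CommRing R] [CommRing S] [Algebra R S]

theorem LinearIndependent.sum_smul_of_mul_eq_one {t n : ℕ} {g : Fin n → S}
    (hg : LinearIndependent R g) {V : Matrix (Fin t) (Fin n) R} {V' : Matrix (Fin n) (Fin t) R}
    (hV : V * V' = 1) : LinearIndependent R fun l => ∑ j, V l j • g j := by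
  rw [Fintype.linearIndependent_iff] at hg ⊢
  intro c hc
  have h0 : c ᵥ* V = 0 := by
    refine funext (hg _ ?_)
    rw [← hc]
    simp only [Matrix.vecMul, dotProduct, Finset.sum_smul, Finset.smul_sum, mul_smul]
    exact Finset.sum_comm
  have h1 : c = 0 := by
    rw [← Matrix.vecMul_one c, ← hV, ← Matrix.vecMul_vecMul, h0, Matrix.zero_vecMul]
  exact congrFun h1

/-- A word of rank `t` is `e_j = ∑ l, V l j • δ l • β l` for `t` linearly independent elements
`β l`, nonzero scalars `δ l` and a right-invertible matrix `V`. -/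
theorem exists_rankNorm_decomposition [PreValuationRing R] {m n : ℕ}
    (γ : Module.Basis (Fin m) R S) (e : Fin n → S) :
    ∃ (β : Fin (rankNorm γ e) → S) (δ : Fin (rankNorm γ e) → R)
      (V : Matrix (Fin (rankNorm γ e)) (Fin n) R) (V' : Matrix (Fin n) (Fin (rankNorm γ e)) R),
      LinearIndependent R β ∧ (∀ l, δ l ≠ 0) ∧ V * V' = 1 ∧
      ∀ j, e j = ∑ l, V l j • δ l • β l := by
  obtain ⟨U, U', δ, V, V', hU, hV, hδ, hM⟩ := exists_rank_factorization (extMatrix γ e)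
  refine ⟨_, δ, V, V', γ.linearIndependent.sum_smul_of_mul_eq_one (V := Uᵀ) (V' := U'ᵀ) ?_,
    hδ, hV, fun j => ?_⟩
  · rw [← Matrix.transpose_mul, hU, Matrix.transpose_one]
  · have h1 : ∀ i, γ.repr (e j) i = ∑ l, U i l * δ l * V l j := fun i => by
      have := congrFun (congrFun hM i) j
      rw [Matrix.mul_apply] at this
      exact this.trans (Finset.sum_congr rfl fun l _ => by rw [Matrix.mul_diagonal])
    conv_lhs => rw [← γ.sum_repr (e j)]
    simp only [h1, Finset.sum_smul, Finset.smul_sum, smul_smul]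
    rw [Finset.sum_comm]
    refine Finset.sum_congr rfl fun l _ => Finset.sum_congr rfl fun i _ => ?_
    rw [Matrix.transpose_apply]
    congr 1
    ring

end RankDecomposition

namespace SkewPolynomial

section Interpolation

theorem IsPrimitive.ne_zero {S : Type*} [CommRing S] [Nontrivial S] {f : SkewPolynomial S}
    (hf : f.IsPrimitive) : f ≠ 0 := by
  rintro rfl
  obtain ⟨i, hi⟩ := hf
  exact not_isUnit_zero hi

open Matrix

variable {S : Type*} [CommRing S] [MulSemiringAction (Multiplicative ℕ) S] {n : ℕ} {g : Fin n → S}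

theorem vecMul_mooreMatrix {f : SkewPolynomial S} (hf : ∀ i, n ≤ i → f.coeff i = 0) :
    (fun i : Fin n => f.coeff i) ᵥ* mooreMatrix n g = fun j => f.opEval (g j) := by
  ext j
  rw [opEval_eq_sum_range f hf, Finset.sum_range]
  rfl

/-- The coefficients of a skew polynomial of degree less than `n` in terms of its values. -/
theorem coeff_eq_vecMul_inv (hM : IsUnit (mooreMatrix n g).det) {f : SkewPolynomial S}
    (hf : ∀ i, n ≤ i → f.coeff i = 0) (i : Fin n) :
    f.coeff i = ((fun j => f.opEval (g j)) ᵥ* (mooreMatrix n g)⁻¹) i := by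
  rw [← vecMul_mooreMatrix hf, Matrix.vecMul_vecMul, Matrix.mul_nonsing_inv _ hM,
    Matrix.vecMul_one]

theorem eq_zero_of_opEval_eq_zero (hM : IsUnit (mooreMatrix n g).det) {f : SkewPolynomial S}
    (hf : ∀ i, n ≤ i → f.coeff i = 0) (h0 : ∀ j, f.opEval (g j) = 0) : f = 0 := by
  ext i
  rcases lt_or_ge i n with hi | hi
  · rw [coeff_eq_vecMul_inv hM hf ⟨i, hi⟩, funext h0]
    exact congrFun (Matrix.zero_vecMul _) _
  · exact hf i hi

theorem exists_interpolation (hM : IsUnit (mooreMatrix n g).det) (r : Fin n → S) :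
    ∃ I : SkewPolynomial S, (∀ i, n ≤ i → I.coeff i = 0) ∧ ∀ j, I.opEval (g j) = r j := by
  have hI : ∀ i, n ≤ i → (∑ l : Fin n, monomial (l : ℕ) ((r ᵥ* (mooreMatrix n g)⁻¹) l)).coeff i
      = 0 := fun i hi => by rw [coeff_sum_monomial, dif_neg (by omega)]
  refine ⟨_, hI, fun j => ?_⟩
  have h := congrFun (vecMul_mooreMatrix (g := g) hI) j
  rw [← h]
  simp only [coeff_sum_monomial, Fin.is_lt, dif_pos]
  rw [Matrix.vecMul_vecMul, Matrix.nonsing_inv_mul _ hM, Matrix.vecMul_one]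

/-- The monic skew polynomial `x ^ n - I`, where `I` interpolates the values of `x ^ n`. -/
theorem exists_monic_vanishing (hM : IsUnit (mooreMatrix n g).det) :
    ∃ G : SkewPolynomial S, (∀ i, n < i → G.coeff i = 0) ∧ G.coeff n = 1 ∧
      ∀ j, G.opEval (g j) = 0 := by
  obtain ⟨I, hI, hIg⟩ := exists_interpolation hM fun j => φ^[n] (g j)
  refine ⟨monomial n 1 - I, fun i hi => ?_, ?_, fun j => ?_⟩
  · rw [coeff_sub, coeff_monomial, if_neg (by omega), hI i (by omega), sub_zero]
  · rw [coeff_sub, coeff_monomial, if_pos rfl, hI n le_rfl, sub_zero]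
  · rw [opEval_sub_left, opEval_monomial, hIg, one_mul, sub_self]

variable {G₀ : SkewPolynomial S}

theorem isAnnihilator_of_monic [Nontrivial S] (hM : IsUnit (mooreMatrix n g).det)
    (hG₀ : ∀ i, n < i → G₀.coeff i = 0) (hG₀n : G₀.coeff n = 1)
    (hv : ∀ j, G₀.opEval (g j) = 0) : IsAnnihilator g G₀ where
  primitive := ⟨n, hG₀n ▸ isUnit_one⟩
  vanish := hv
  minimal L hL hLv := by
    refine (degree_le_iff.mpr hG₀).trans (le_of_not_gt fun h => ?_)
    exact hL.ne_zero (eq_zero_of_opEval_eq_zero hM (degree_lt_iff.mp h) hLv)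

/-- The annihilator polynomials of a family with invertible Moore matrix are the unit multiples of
the monic one. -/
theorem IsAnnihilator.exists_eq_monomial_mul (hM : IsUnit (mooreMatrix n g).det)
    (hG₀ : ∀ i, n < i → G₀.coeff i = 0) (hG₀n : G₀.coeff n = 1)
    (hv : ∀ j, G₀.opEval (g j) = 0) {G : SkewPolynomial S} (hG : IsAnnihilator g G) :
    (∀ i, n < i → G.coeff i = 0) ∧ IsUnit (G.coeff n) ∧ G = monomial 0 (G.coeff n) * G₀ := by
  have hdeg : ∀ i, n < i → G.coeff i = 0 := degree_le_iff.mp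
    ((hG.minimal G₀ ⟨n, hG₀n ▸ isUnit_one⟩ hv).trans (degree_le_iff.mpr hG₀))
  have hcoeff : ∀ i, (monomial 0 (G.coeff n) * G₀).coeff i = G.coeff n * G₀.coeff i := fun i => by
    rw [coeff_monomial_mul, if_pos (Nat.zero_le i)]; rfl
  have heq : G = monomial 0 (G.coeff n) * G₀ := by
    refine sub_eq_zero.mp (eq_zero_of_opEval_eq_zero hM (fun i hi => ?_) fun j => ?_)
    · rw [coeff_sub, hcoeff]
      rcases hi.eq_or_lt with rfl | hi
      · rw [hG₀n, mul_one, sub_self]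
      · rw [hdeg i hi, hG₀ i hi, mul_zero, sub_self]
    · rw [opEval_sub_left, opEval_mul, hG.vanish, hv, opEval_zero, sub_self]
  refine ⟨hdeg, ?_, heq⟩
  obtain ⟨i, hi⟩ := hG.primitive
  rw [heq, hcoeff] at hi
  exact isUnit_of_mul_isUnit_left hi

theorem existsUnique_monic_isAnnihilator [Nontrivial S] (hM : IsUnit (mooreMatrix n g).det) :
    ∃! G : SkewPolynomial S, G.IsMonic ∧ IsAnnihilator g G := by
  obtain ⟨G₀, hG₀, hG₀n, hv⟩ := exists_monic_vanishing hM
  refine ⟨G₀, ⟨⟨n, degree_eq_of_coeff_ne_zero hG₀ (hG₀n ▸ one_ne_zero), hG₀n⟩,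
    isAnnihilator_of_monic hM hG₀ hG₀n hv⟩, ?_⟩
  rintro G ⟨⟨d, hd, hd1⟩, hG⟩
  obtain ⟨hdeg, hu, heq⟩ := hG.exists_eq_monomial_mul hM hG₀ hG₀n hv
  have hdn : d = n := by
    have := hd.symm.trans (degree_eq_of_coeff_ne_zero hdeg hu.ne_zero)
    exact_mod_cast this
  subst hdn
  rw [heq, hd1]
  exact one_mul G₀

theorem existsUnique_interpolation (hM : IsUnit (mooreMatrix n g).det) (r : Fin n → S) :
    ∃! I : SkewPolynomial S, I.degree < n ∧ ∀ i, I.opEval (g i) = r i := by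
  obtain ⟨I, hI, hIr⟩ := exists_interpolation hM r
  refine ⟨I, ⟨degree_lt_iff.mpr hI, hIr⟩, ?_⟩
  rintro J ⟨hJ, hJr⟩
  refine sub_eq_zero.mp (eq_zero_of_opEval_eq_zero hM (fun i hi => ?_) fun j => ?_)
  · rw [coeff_sub, degree_lt_iff.mp hJ i hi, hI i hi, sub_zero]
  · rw [opEval_sub_left, hIr, hJr, sub_self]

/-- A skew polynomial that vanishes on `g` is a left multiple of every annihilator of `g`. -/
theorem IsAnnihilator.exists_eq_mul (hM : IsUnit (mooreMatrix n g).det)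
    {G : SkewPolynomial S} (hG : IsAnnihilator g G) {f : SkewPolynomial S}
    (hf : ∀ j, f.opEval (g j) = 0) : ∃ q, f = q * G := by
  obtain ⟨G₀, hG₀, hG₀n, hv⟩ := exists_monic_vanishing hM
  obtain ⟨-, ⟨c, hc⟩, heq⟩ := hG.exists_eq_monomial_mul hM hG₀ hG₀n hv
  obtain ⟨q, hq⟩ := exists_coeff_sub_mul_eq_zero hG₀ hG₀n f
  -- the remainder of `f` vanishes on `g` and has degree less than `n`
  have h0 : f - q * G₀ = 0 := eq_zero_of_opEval_eq_zero hM hq fun j => by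
    rw [opEval_sub_left, hf, opEval_mul, hv, opEval_zero, sub_self]
  have hG' : monomial 0 (↑c⁻¹ : S) * G = G₀ := by
    rw [heq, ← mul_assoc, monomial_mul_monomial, ← hc]
    change monomial 0 (↑c⁻¹ * ↑c : S) * G₀ = G₀
    rw [Units.inv_mul, monomial_zero_one, one_mul]
  exact ⟨q * monomial 0 (↑c⁻¹ : S), by rw [mul_assoc, hG', sub_eq_zero.mp h0]⟩

end Interpolation

end SkewPolynomial

/-! ### The key equation -/

namespace SkewPolynomial

open Matrix IsLocalRing

variable {R S : Type*} [CommRing R] [CommRing S] [Algebra R S]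
  [MulSemiringAction (Multiplicative ℕ) S] {n t : ℕ}

theorem coeff_syndromePoly {N : ℕ} (h y : Fin n → S) {i : ℕ} (hi : i < N) :
    (syndromePoly N h y).coeff i = ∑ j, φ^[i] (h j) * y j := by
  rw [syndromePoly, coeff_sum_monomial, dif_pos hi]
  rfl

theorem iterate_smul (hφ : ∀ r : R, (φ (algebraMap R S r) : S) = algebraMap R S r) (i : ℕ) (r : R)
    (a : S) : φ^[i] (r • a) = r • φ^[i] a := by
  rw [Algebra.smul_def, iterate_map_mul, Function.iterate_fixed (hφ r), Algebra.smul_def]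

theorem opEval_smul (hφ : ∀ r : R, (φ (algebraMap R S r) : S) = algebraMap R S r)
    (f : SkewPolynomial S) (r : R) (a : S) : f.opEval (r • a) = r • f.opEval a := by
  rw [Algebra.smul_def, opEval_mul_of_fixed f (hφ r), Algebra.smul_def]

theorem iterate_sum {ι : Type*} (i : ℕ) (s : Finset ι) (a : ι → S) :
    φ^[i] (∑ j ∈ s, a j) = ∑ j ∈ s, φ^[i] (a j) := by
  simpa using opEval_sum (monomial i 1) s a

/-- In high degrees, the product with a syndrome polynomial evaluates `u` at the word: for
`y_j = ∑ l, V l j • ε l` and `w l = ∑ j, V l j • h j`, the coefficient of `x ^ i` in `u * s` is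
`∑ l, φ ^ i (w l) * u (ε l)` as soon as `deg u ≤ i`. -/
theorem coeff_mul_syndromePoly (hφ : ∀ r : R, (φ (algebraMap R S r) : S) = algebraMap R S r)
    {N : ℕ} {h y : Fin n → S} {ε : Fin t → S} {V : Matrix (Fin t) (Fin n) R}
    (hy : ∀ j, y j = ∑ l, V l j • ε l) {u : SkewPolynomial S} {i : ℕ} (hi : i < N)
    (hu : ∀ a, i < a → u.coeff a = 0) :
    (u * syndromePoly N h y).coeff i =
      ∑ l, φ^[i] (∑ j, V l j • h j) * u.opEval (ε l) := by
  have hs : ∀ i' < N, (syndromePoly N h y).coeff i' =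
      ∑ l, φ^[i'] (∑ j, V l j • h j) * ε l := fun i' hi' => by
    rw [coeff_syndromePoly h y hi']
    have : ∀ l, φ^[i'] (∑ j, V l j • h j) = ∑ j, V l j • φ^[i'] (h j) := fun l => by
      simp only [iterate_sum, iterate_smul hφ]
    simp only [hy, this, Finset.mul_sum, Finset.sum_mul, smul_mul_assoc, mul_smul_comm]
    exact Finset.sum_comm
  rw [coeff_mul]
  have hterm : ∀ a ∈ Finset.range (i + 1),
      u.coeff a * φ^[a] ((syndromePoly N h y).coeff (i - a)) =
        ∑ l, φ^[i] (∑ j, V l j • h j) * (u.coeff a * φ^[a] (ε l)) := fun a ha => by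
    have ha' : a ≤ i := Nat.lt_succ_iff.mp (Finset.mem_range.mp ha)
    rw [hs _ (by omega), iterate_sum, Finset.mul_sum]
    refine Finset.sum_congr rfl fun l _ => ?_
    rw [iterate_map_mul, ← Function.iterate_add_apply, Nat.add_sub_cancel' ha']
    ring
  rw [Finset.sum_congr rfl hterm, Finset.sum_comm]
  refine Finset.sum_congr rfl fun l _ => ?_
  rw [opEval_eq_sum_range u (N := i + 1) fun a ha => hu a (by omega), Finset.mul_sum]

theorem linearIndependent_iterate (hφ : ∀ r : R, (φ (algebraMap R S r) : S) = algebraMap R S r)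
    (hinj : Function.Injective (φ : S → S)) {w : Fin t → S} (hw : LinearIndependent R w) (i : ℕ) :
    LinearIndependent R fun l => φ^[i] (w l) := by
  rw [Fintype.linearIndependent_iff] at hw ⊢
  intro c hc
  refine hw c (hinj.iterate i ?_)
  rw [iterate_map_zero, ← hc]
  simp only [iterate_sum, iterate_smul hφ]

/-- A word whose syndrome polynomial `s` satisfies the key equation `u * s ≡ v` is annihilated by
`u`: the coefficients of `x ^ t, …, x ^ (2 t - 1)` form a linear system with an invertible Moore
matrix in the values of `u`. -/
theorem opEval_eq_zero_of_key_equation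
    (hφ : ∀ r : R, (φ (algebraMap R S r) : S) = algebraMap R S r)
    (hinj : Function.Injective (φ : S → S))
    (hMoore : ∀ w : Fin t → S, LinearIndependent R w → IsUnit (mooreMatrix t w).det)
    {N : ℕ} (htN : 2 * t ≤ N) {h y : Fin n → S} (hh : LinearIndependent R h) {ε : Fin t → S}
    {V : Matrix (Fin t) (Fin n) R} {V' : Matrix (Fin n) (Fin t) R} (hV : V * V' = 1)
    (hy : ∀ j, y j = ∑ l, V l j • ε l) {u : SkewPolynomial S}
    (hu : ∀ a, t < a → u.coeff a = 0)
    (hkey : ∀ i, t ≤ i → i < N → (u * syndromePoly N h y).coeff i = 0) (j : Fin n) :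
    u.opEval (y j) = 0 := by
  have hM := hMoore _ (linearIndependent_iterate hφ hinj (hh.sum_smul_of_mul_eq_one hV) t)
  have h0 : mooreMatrix t (fun l => φ^[t] (∑ j, V l j • h j)) *ᵥ (fun l => u.opEval (ε l)) = 0 := by
    ext i
    have h1 := hkey (i + t) (by omega) (by omega)
    rw [coeff_mul_syndromePoly hφ hy (by omega) fun a ha => hu a (by omega)] at h1
    rw [Pi.zero_apply, ← h1]
    simp only [mooreMatrix, Matrix.mulVec, dotProduct, Matrix.of_apply,
      Function.iterate_add_apply]
  have h1 : (fun l => u.opEval (ε l)) = 0 :=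
    Matrix.mulVec_injective_of_isUnit ((Matrix.isUnit_iff_isUnit_det _).mpr hM)
      (h0.trans (Matrix.mulVec_zero _).symm)
  rw [hy, opEval_sum]
  exact Finset.sum_eq_zero fun l _ => by rw [opEval_smul hφ, congrFun h1 l]; exact smul_zero _

/-- A primitive skew polynomial vanishing on a word of rank `t` has degree at least `t`: modulo the
maximal ideal it vanishes on `t` linearly independent elements. -/
theorem IsPrimitive.le_degree_of_opEval_eq_zero [IsLocalRing S]
    (hφ : ∀ r : R, (φ (algebraMap R S r) : S) = algebraMap R S r)
    (hRS : Function.Injective (algebraMap R S))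
    {β : Fin t → S} (hM : IsUnit (mooreMatrix t β).det) {δ : Fin t → R}
    (hδ : ∀ l, δ l ≠ 0) {V : Matrix (Fin t) (Fin n) R} {V' : Matrix (Fin n) (Fin t) R}
    (hV : V * V' = 1) {y : Fin n → S} (hy : ∀ j, y j = ∑ l, V l j • δ l • β l)
    {L : SkewPolynomial S} (hL : L.IsPrimitive) (hLy : ∀ j, L.opEval (y j) = 0) :
    (t : WithBot ℕ) ≤ L.degree := by
  have hLβ : ∀ l, L.opEval (β l) ∈ maximalIdeal S := by
    intro l hu
    have h1 : δ l • β l = ∑ j, V' j l • y j := by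
      have h2 : ∀ l', ∑ j, V' j l * V l' j = (1 : Matrix (Fin t) (Fin t) R) l' l := fun l' => by
        rw [← hV, Matrix.mul_apply]
        exact Finset.sum_congr rfl fun j _ => mul_comm _ _
      simp only [hy, Finset.smul_sum (s := Finset.univ)]
      rw [Finset.sum_comm]
      simp only [smul_smul (V' _ l), ← Finset.sum_smul, h2, Matrix.one_apply, ite_smul, one_smul,
        zero_smul, Finset.sum_ite_eq', Finset.mem_univ, if_true]
    have h2 : δ l • L.opEval (β l) = 0 := by
      rw [← opEval_smul hφ, h1, opEval_sum]
      exact Finset.sum_eq_zero fun j _ => by rw [opEval_smul hφ, hLy, smul_zero]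
    rw [Algebra.smul_def, hu.mul_left_eq_zero] at h2
    exact hδ l ((map_eq_zero_iff _ hRS).mp h2)
  by_contra hlt
  obtain ⟨i, hi⟩ := hL
  have hdeg := degree_lt_iff.mp (not_le.mp hlt)
  rcases lt_or_ge i t with hit | hit
  · rw [coeff_eq_vecMul_inv hM hdeg ⟨i, hit⟩] at hi
    refine absurd hi (show _ ∈ maximalIdeal S from ?_)
    rw [Matrix.vecMul, dotProduct]
    exact Ideal.sum_mem _ fun l _ => Ideal.mul_mem_right _ _ (hLβ l)
  · rw [hdeg i hit] at hi
    exact not_isUnit_zero hi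

end SkewPolynomial

/-! ### Decoding Gabidulin codes -/

theorem mainTheorem3 {R S : Type*} [CommRing R] [CommRing S] [Algebra R S]
    -- the Galois rings `R = GR(p^ν, d) ⊆ S = GR(p^ν, d m)` and a basis of `S` over `R`
    (p ν d m : ℕ) (hR : IsGaloisRing p ν d R) (hS : IsGaloisRing p ν (d * m) S)
    (hRS : Function.Injective (algebraMap R S)) (γ : Module.Basis (Fin m) R S)
    -- a generator `σ` of the Galois group; `SkewPolynomial S` is `S[x; σ]`
    (σ : S ≃ₐ[R] S) (hσ : ∀ τ : S ≃ₐ[R] S, τ ∈ Subgroup.zpowers σ)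
    [MulSemiringAction (Multiplicative ℕ) S]
    (hφ : ∀ a : S, SkewPolynomial.φ a = σ a)
    -- the code, and `h` whose Moore matrix is a parity-check matrix
    (n k : ℕ) (hk : 0 < k) (hkn : k ≤ n)
    (g : Fin n → S) (hg : LinearIndependent R g)
    (h : Fin n → S) (hh : LinearIndependent R h)
    (hH : IsParityCheckMatrix (SkewPolynomial.mooreMatrix (n - k) h)
      (SkewPolynomial.gabidulinCode g k))
    -- the message polynomial `f`, the codeword `c`, the error `e` and the received word `r`
    (f : SkewPolynomial S) (hf : f.degree < k)
    (c e r : Fin n → S) (hc : c = fun j => f.opEval (g j)) (hr : r = c + e)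
    (t : ℕ) (ht : t = rankNorm γ e) (htn : 2 * t ≤ n - k)
    -- the solution of the key equation
    (u v : SkewPolynomial S) (hu : u.IsPrimitive)
    (huv : SkewPolynomial.RightModEq (SkewPolynomial.X ^ (n - k))
      (u * SkewPolynomial.syndromePoly (n - k) h r) v)
    (hut : u.degree ≤ t) (hvu : v.degree < u.degree) :
    SkewPolynomial.IsAnnihilator e u ∧ u.degree = t ∧
    (∃! I : SkewPolynomial S, I.degree < n ∧ ∀ i, I.opEval (g i) = r i) ∧
    (∃! G : SkewPolynomial S, G.IsMonic ∧ SkewPolynomial.IsAnnihilator g G) ∧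
    ∀ I G : SkewPolynomial S, I.degree < n → (∀ i, I.opEval (g i) = r i) →
      SkewPolynomial.IsAnnihilator g G →
      G.degree = n ∧ SkewPolynomial.RightModEq G (u * I) (u * f) := by
  subst ht
  have := hR.isLocalRing
  have := hS.isLocalRing
  have := hR.preValuationRing
  have hφR : ∀ x : R, (SkewPolynomial.φ (algebraMap R S x) : S) = algebraMap R S x :=
    fun x => by rw [hφ, AlgEquiv.commutes]
  have hφinj : Function.Injective (SkewPolynomial.φ : S → S) := fun a b hab =>
    σ.injective (by rwa [hφ, hφ] at hab)
  have hMoore : ∀ {N : ℕ} (w : Fin N → S), LinearIndependent R w →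
      IsUnit (SkewPolynomial.mooreMatrix N w).det :=
    fun w hw => isUnit_det_mooreMatrix hR hS σ hσ hφ hw
  obtain ⟨β, δ, V, V', hβ, hδ, hV, he⟩ := exists_rankNorm_decomposition γ e
  have hu_coeff := SkewPolynomial.degree_le_iff.mp hut
  have hv_coeff := SkewPolynomial.degree_lt_iff.mp (hvu.trans_le hut)
  -- the syndrome of `r` is that of `e`
  have hs : SkewPolynomial.syndromePoly (n - k) h r = SkewPolynomial.syndromePoly (n - k) h e := by
    have hc0 := (hH c).mp ⟨f, hf, hc⟩
    simp only [SkewPolynomial.syndromePoly, hr, Matrix.mulVec_add, hc0, zero_add]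
  obtain ⟨q, hq⟩ := huv
  rw [hs] at hq
  have hue : ∀ j, u.opEval (e j) = 0 := by
    refine SkewPolynomial.opEval_eq_zero_of_key_equation hφR hφinj (fun w => hMoore w) htn hh hV he
      hu_coeff fun i hi hiN => ?_
    have h1 := congrArg (fun P : SkewPolynomial S => P.coeff i) hq
    simpa only [SkewPolynomial.coeff_sub, SkewPolynomial.coeff_mul_X_pow_of_lt q hiN,
      hv_coeff i hi, sub_zero] using h1
  have hmin : ∀ L : SkewPolynomial S, L.IsPrimitive → (∀ j, L.opEval (e j) = 0) →
      ((rankNorm γ e : ℕ) : WithBot ℕ) ≤ L.degree := fun L hL hLe =>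
    hL.le_degree_of_opEval_eq_zero hφR hRS (hMoore β hβ) hδ hV he hLe
  refine ⟨⟨hu, hue, fun L hL hLe => hut.trans (hmin L hL hLe)⟩, le_antisymm hut (hmin u hu hue),
    SkewPolynomial.existsUnique_interpolation (hMoore g hg) r,
    SkewPolynomial.existsUnique_monic_isAnnihilator (hMoore g hg), fun I G _ hIr hG => ⟨?_, ?_⟩⟩
  · obtain ⟨G₀, hG₀, hG₀n, hv⟩ := SkewPolynomial.exists_monic_vanishing (hMoore g hg)
    obtain ⟨hdeg, hunit, -⟩ := hG.exists_eq_monomial_mul (hMoore g hg) hG₀ hG₀n hv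
    exact SkewPolynomial.degree_eq_of_coeff_ne_zero hdeg hunit.ne_zero
  · -- `u * I - u * f` takes the value `u (e j)` at `g j`
    refine hG.exists_eq_mul (hMoore g hg) fun j => ?_
    have hej : r j - f.opEval (g j) = e j := by
      rw [hr, Pi.add_apply, hc, add_sub_cancel_left]
    rw [← mul_sub, SkewPolynomial.opEval_mul, SkewPolynomial.opEval_sub_left, hIr, hej, hue]
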